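/- Theorem 2.3 (Instability with respect to affine transformation). Let $\gamma(dz)=(2\pi)^{-1/2}e^{-z^2/2}\,dz$ be the standard Gaussian distribution on $\mathbb{R}$, let $Z$ be a random variable with distribution $\gamma$, and let $H_m(x)=(-1)^m e^{x^2/2}\frac{d^m}{dx^m}e^{-x^2/2}$, $m\ge 0$, be the Hermite polynomials. The Hermite rank of $f\in L^2(\gamma)$ is $\inf\{m\ge 1:\ \mathbb{E}[f(Z)H_m(Z)]\ne 0\}\in\{1,2,\ldots\}\cup\{\infty\}$, with $\inf\emptyset=\infty$. Let $M_1,M_2\in\mathbb{R}$, and let $G:\mathbb{R}\to\mathbb{R}$ be a (Lebesgue) measurable function that is not almost everywhere equal to a constant and such that both functions $z\mapsto G(M_1+zM_2)$ and $z\mapsto G(-M_1+zM_2)$ belong to $L^2(\gamma)$. Then, for all $(x,y)\in(-M_1,M_1)\times(0,M_2)$, the function $z\mapsto G(x+zy)$ belongs to $L^2(\gamma)$ (so that its Hermite rank is defined), and the set \[ E=\{(x,y)\in(-M_1,M_1)\times(0,M_2):\ z\mapsto G(x+zy)\ \text{has Hermite rank}\ \ge 2\}\subset\mathbb{R}^2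 \] has Hausdorff dimension at most $1$. In particular, $E$ has two-dimensional Lebesgue measure zero. (If $M_1\le 0$ or $M_2\le 0$, then $(-M_1,M_1)\times(0,M_2)$ is empty and the conclusion is trivial.) -/

import Mathlib

open MeasureTheory ProbabilityTheory

/-- The standard Gaussian distribution `γ(dx) = (2π)^{-1/2} exp(-x²/2) dx` on the real line. -/
noncomputable def stdGaussian1 : Measure ℝ := gaussianReal 0 1

/-- `E[G(Z) H_m(Z)]` for a standard Gaussian `Z`, where `H_m` is the `m`-th (probabilists')
Hermite polynomial: `H_0 = 1`, `H_1 = x`, `H_2 = x² - 1`, and so on. -/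
noncomputable def hermiteMoment (G : ℝ → ℝ) (m : ℕ) : ℝ :=
  ∫ z, G z * Polynomial.aeval z (Polynomial.hermite m) ∂stdGaussian1

/-- The Hermite rank of `G ∈ L²(γ)`: the infimum of all `m ≥ 1` with `E[G(Z) H_m(Z)] ≠ 0`.
The infimum of the empty set is `∞` (this is the case of an a.e. constant `G`). -/
noncomputable def hermiteRank (G : ℝ → ℝ) : ℕ∞ :=
  sInf {k : ℕ∞ | ∃ m : ℕ, 1 ≤ m ∧ hermiteMoment G m ≠ 0 ∧ k = (m : ℕ∞)}

/-- The set of all `(x, y) ∈ (-M₁, M₁) × (0, M₂)` for which `z ↦ G(x + z y)` has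
Hermite rank at least `2`. -/
def highRankSet (G : ℝ → ℝ) (M₁ M₂ : ℝ) : Set (ℝ × ℝ) :=
  {p | p ∈ Set.Ioo (-M₁) M₁ ×ˢ Set.Ioo 0 M₂ ∧ 2 ≤ hermiteRank (fun z => G (p.1 + z * p.2))}

/-!
Substituting `u = x + z y`, the `n`-th Hermite moment of `z ↦ G(x + z y)` becomes, up to the positive
factor `(√(2π) y)⁻¹`, the transform
`B_n(x, y) = ∫ G(u) H_n((u - x) / y) exp(-((u - x) / y)² / 2) du`.
All parameters now sit in a Gaussian kernel of scale `y < M₂`, which is dominated, locally uniformly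
in `(x, y)`, by the kernel of scale `M₂` against which `G` and `G²` are integrable by assumption
(`eventually_abs_gaussKernel_le`). This gives both the square integrability and the continuous
differentiability of `B_n`, and since `H_{n+1} = X H_n - H_n'`, one gets `∂ₓ B_n = y⁻¹ B_{n+1}`
(`hasStrictFDerivAt_gaussTransform`).

At a point of the high rank set `B_1` vanishes. Not all `B_n` with `n ≥ 1` can vanish there: by
completeness of the Hermite polynomials (`ae_eq_zero_of_integral_mul_hermiteReal`) the function
`z ↦ G(x + z y)`, and with it `G`, would be almost everywhere constant. If `B_{n+2}` is the first that
does not vanish, the point lies on the zero set of `B_{n+1}` while `∂ₓ B_{n+1} ≠ 0`. So the high rank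
set is covered by countably many pieces, each of which is locally a Lipschitz graph over the `y`-axis
and hence of dimension at most one (`dimH_le_one_of_hasStrictFDerivAt`). No theory of zero sets of
real analytic functions of two variables is needed.
-/

/-! ### Regular zero sets in the plane -/

/-- A planar set on which a function vanishes whose strict derivative has nonzero first partial
derivative at each point of the set is locally the graph of a Lipschitz function of the second
coordinate; hence its Hausdorff dimension is at most `1`. -/
theorem dimH_le_one_of_hasStrictFDerivAt {S : Set (ℝ × ℝ)} {g : ℝ × ℝ → ℝ}
    (hzero : ∀ p ∈ S, g p = 0)
    (hderiv : ∀ p ∈ S, ∃ g' : ℝ × ℝ →L[ℝ] ℝ, HasStrictFDerivAt g g' p ∧ g' (1, 0) ≠ 0) :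
    dimH S ≤ 1 := by
  by_contra! hlt
  obtain ⟨p, hpS, hp⟩ := exists_mem_nhdsWithin_lt_dimH_of_lt_dimH hlt
  obtain ⟨g', hg', ha⟩ := hderiv p hpS
  set a := g' (1, 0) with ha_def
  set b := g' (0, 1) with hb_def
  have ha' : 0 < |a| := abs_pos.mpr ha
  have hlin : ∀ v : ℝ × ℝ, g' v = a * v.1 + b * v.2 := by
    intro v
    have hv : v = v.1 • ((1, 0) : ℝ × ℝ) + v.2 • ((0, 1) : ℝ × ℝ) := by
      ext <;> simp
    rw [hv, map_add, map_smul, map_smul]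
    simp [ha_def, hb_def, mul_comm]
  obtain ⟨t, ht, happ⟩ : ∃ t ∈ nhds p, ∀ q ∈ t, ∀ r ∈ t,
      ‖g q - g r - g' (q - r)‖ ≤ |a| / 2 * ‖q - r‖ := by
    have h := (hg'.isLittleO).def (half_pos ha')
    rw [nhds_prod_eq] at h
    obtain ⟨P, hP, Q, hQ, hPQ⟩ := Filter.eventually_prod_iff.mp h
    exact ⟨_, hP.and hQ, fun q hq r hr => hPQ hq.1 hr.2⟩
  refine absurd (hp (S ∩ t) (Filter.inter_mem self_mem_nhdsWithin (mem_nhdsWithin_of_mem_nhds ht)))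
    (not_lt.mpr ?_)
  let K : ℝ := 2 * |b| / |a| + 1
  have hK1 : 1 ≤ K := le_add_of_nonneg_left (by positivity)
  have hanti : AntilipschitzWith K.toNNReal (fun q : ↥(S ∩ t) => q.1.2) := by
    refine AntilipschitzWith.of_le_mul_dist fun q r => ?_
    rw [Real.coe_toNNReal _ (by linarith), Subtype.dist_eq, Prod.dist_eq]
    refine max_le ?_ (le_mul_of_one_le_left dist_nonneg hK1)
    have h := happ q q.2.2 r r.2.2
    rw [hzero _ q.2.1, hzero _ r.2.1, hlin, Prod.norm_def] at h
    simp only [sub_zero, zero_sub, norm_neg, Prod.fst_sub, Prod.snd_sub, Real.norm_eq_abs] at h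
    rw [Real.dist_eq, Real.dist_eq]
    set X := q.1.1 - r.1.1
    set Y := q.1.2 - r.1.2
    -- `h` says `|a X + b Y| ≤ (|a| / 2) max |X| |Y|`, which bounds `X` by a multiple of `Y`
    have hm : max |X| |Y| ≤ |X| + |Y| :=
      max_le (le_add_of_nonneg_right (abs_nonneg _)) (le_add_of_nonneg_left (abs_nonneg _))
    have h1 : |a| * |X| ≤ |a * X + b * Y| + |b| * |Y| := by
      rw [← abs_mul, ← abs_mul]
      calc |a * X| = |(a * X + b * Y) - b * Y| := by ring_nf
        _ ≤ _ := abs_sub _ _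
    have h2 : |a| / 2 * max |X| |Y| ≤ |a| / 2 * (|X| + |Y|) :=
      mul_le_mul_of_nonneg_left hm (by positivity)
    have h3 : |a| * |X| ≤ |a| * (K * |Y|) := by
      have : |a| * (K * |Y|) = 2 * |b| * |Y| + |a| * |Y| := by
        simp only [K]; field_simp
      rw [this]; linarith
    exact le_of_mul_le_mul_left h3 ha'
  calc dimH (S ∩ t) = dimH ((Subtype.val : ↥(S ∩ t) → ℝ × ℝ) '' Set.univ) := by simp
    _ = dimH (Set.univ : Set ↥(S ∩ t)) := isometry_subtype_coe.dimH_image _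
    _ ≤ dimH ((fun q : ↥(S ∩ t) => q.1.2) '' Set.univ) := hanti.le_dimH_image _
    _ ≤ dimH (Set.univ : Set ℝ) := dimH_mono (Set.subset_univ _)
    _ = 1 := Real.dimH_univ

/-! ### Moments determine densities with exponential integrability -/

theorem integrable_mul_eval_of_integrable_mul_exp {μ : Measure ℝ} {h : ℝ → ℝ}
    (hint : ∀ t : ℝ, Integrable (fun z => h z * Real.exp (t * |z|)) μ) (p : Polynomial ℝ) :
    Integrable (fun z => h z * p.eval z) μ := by
  have hh : AEStronglyMeasurable h μ := by simpa using (hint 0).aestronglyMeasurable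
  induction p using Polynomial.induction_on' with
  | add p q hp hq => simpa only [Polynomial.eval_add, mul_add] using hp.fun_add hq
  | monomial n c =>
    refine ((hint 1).norm.const_mul (|c| * n.factorial)).mono'
      (hh.mul (Polynomial.continuous _).aestronglyMeasurable) (Filter.Eventually.of_forall fun z => ?_)
    have h1 := Real.pow_div_factorial_le_exp |z| (abs_nonneg z) n
    rw [div_le_iff₀ (by positivity)] at h1
    simp only [Polynomial.eval_monomial, norm_mul, norm_pow, Real.norm_eq_abs, one_mul, Real.abs_exp]
    calc |h z| * (|c| * |z| ^ n) ≤ |h z| * (|c| * (Real.exp |z| * n.factorial)) := by gcongr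
      _ = _ := by ring

/-- The Fourier transform of `h μ` vanishes when all moments do: with exponential integrability it
may be expanded in its power series term by term. -/
theorem integral_mul_cexp_eq_zero_of_moments {μ : Measure ℝ} {h : ℝ → ℝ}
    (hint : ∀ t : ℝ, Integrable (fun z => h z * Real.exp (t * |z|)) μ)
    (hmom : ∀ n : ℕ, ∫ z, h z * z ^ n ∂μ = 0) (t : ℝ) :
    ∫ z, (h z : ℂ) * Complex.exp (t * z * Complex.I) ∂μ = 0 := by
  have hh : AEStronglyMeasurable h μ := by simpa using (hint 0).aestronglyMeasurable
  have hexp : ∀ z : ℝ, HasSum (fun n : ℕ => |h z| * ((|t| * |z|) ^ n / n.factorial))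
      (|h z| * Real.exp (|t| * |z|)) := fun z => by
    rw [Real.exp_eq_exp_ℝ]
    exact (NormedSpace.expSeries_div_hasSum_exp (|t| * |z|)).mul_left _
  have hcexp : ∀ w : ℂ, HasSum (fun n : ℕ => w ^ n / n.factorial) (Complex.exp w) := fun w => by
    rw [Complex.exp_eq_exp_ℂ]
    exact NormedSpace.expSeries_div_hasSum_exp w
  have key := hasSum_integral_of_dominated_convergence (μ := μ)
    (F := fun (n : ℕ) (z : ℝ) => (h z : ℂ) * ((t * z * Complex.I) ^ n / n.factorial))
    (f := fun z => (h z : ℂ) * Complex.exp (t * z * Complex.I))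
    (fun n z => |h z| * ((|t| * |z|) ^ n / n.factorial))
    (fun n => (Complex.continuous_ofReal.comp_aestronglyMeasurable hh).mul
      (by fun_prop))
    (fun n => Filter.Eventually.of_forall fun z => by simp)
    (Filter.Eventually.of_forall fun z => (hexp z).summable)
    (by
      simp_rw [fun z => (hexp z).tsum_eq]
      exact (hint |t|).norm.congr (Filter.Eventually.of_forall fun z => by simp))
    (Filter.Eventually.of_forall fun z => (hcexp (t * z * Complex.I)).mul_left (h z : ℂ))
  have hz : ∀ n : ℕ, ∫ z, (h z : ℂ) * ((t * z * Complex.I) ^ n / n.factorial) ∂μ = 0 := by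
    intro n
    have : ∀ z : ℝ, (h z : ℂ) * ((t * z * Complex.I) ^ n / n.factorial)
        = ((t * Complex.I) ^ n / n.factorial) * ((h z * z ^ n : ℝ) : ℂ) := fun z => by
      push_cast; ring
    simp_rw [this]
    rw [integral_const_mul, integral_complex_ofReal, hmom]
    simp
  simp_rw [hz] at key
  exact key.unique hasSum_zero

/-- Determinacy of the moment problem for densities with exponential integrability: the positive
and negative parts of `h μ` are finite measures with the same characteristic function. -/
theorem ae_eq_zero_of_moments {μ : Measure ℝ} {h : ℝ → ℝ}
    (hint : ∀ t : ℝ, Integrable (fun z => h z * Real.exp (t * |z|)) μ)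
    (hmom : ∀ n : ℕ, ∫ z, h z * z ^ n ∂μ = 0) : h =ᵐ[μ] 0 := by
  have h0 : Integrable h μ := by simpa using hint 0
  have hpos : AEMeasurable (fun z => ENNReal.ofReal (h z)) μ := h0.aemeasurable.ennreal_ofReal
  have hneg : AEMeasurable (fun z => ENNReal.ofReal (-h z)) μ := h0.aemeasurable.neg.ennreal_ofReal
  have hfin := isFiniteMeasure_withDensity_ofReal h0.2
  have hfin' := isFiniteMeasure_withDensity_ofReal h0.neg.2
  have heq : μ.withDensity (fun z => ENNReal.ofReal (h z))
      = μ.withDensity (fun z => ENNReal.ofReal (-h z)) := by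
    refine @Measure.ext_of_charFun _ _ _ _ _ _ _ _ _ hfin hfin' (funext fun t => ?_)
    rw [charFun_apply_real, charFun_apply_real,
      integral_withDensity_eq_integral_toReal_smul₀ hpos (by simp),
      integral_withDensity_eq_integral_toReal_smul₀ hneg (by simp), ← sub_eq_zero,
      ← integral_sub, ← integral_mul_cexp_eq_zero_of_moments hint hmom t]
    · refine integral_congr_ae (Filter.Eventually.of_forall fun z => ?_)
      have : (h z : ℂ) = ((ENNReal.ofReal (h z)).toReal : ℂ) - ((ENNReal.ofReal (-h z)).toReal : ℂ) := by
        rw [ENNReal.toReal_ofReal', ENNReal.toReal_ofReal', ← Complex.ofReal_sub,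
          max_zero_sub_max_neg_zero_eq_self]
      simp only [Complex.real_smul]
      rw [this]; ring
    all_goals
      refine h0.norm.mono' (by
        first
        | exact hpos.ennreal_toReal.aestronglyMeasurable.smul (by fun_prop)
        | exact hneg.ennreal_toReal.aestronglyMeasurable.smul (by fun_prop))
        (Filter.Eventually.of_forall fun z => ?_)
      have : ‖Complex.exp (t * z * Complex.I)‖ = 1 := by
        exact_mod_cast Complex.norm_exp_ofReal_mul_I (t * z)
      rw [norm_smul, this, mul_one, ENNReal.toReal_ofReal', Real.norm_eq_abs, Real.norm_eq_abs,
        abs_of_nonneg (le_max_right _ _)]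
      simp [le_abs_self, neg_le_abs]
  have hae := (withDensity_eq_iff hpos hneg h0.lintegral_lt_top.ne).mp heq
  filter_upwards [hae] with z hz
  rcases le_total 0 (h z) with hc | hc
  · rw [ENNReal.ofReal_of_nonpos (neg_nonpos.mpr hc)] at hz
    exact le_antisymm (ENNReal.ofReal_eq_zero.mp hz) hc
  · rw [ENNReal.ofReal_of_nonpos hc] at hz
    exact le_antisymm hc (neg_nonpos.mp (ENNReal.ofReal_eq_zero.mp hz.symm))

/-! ### Completeness of the Hermite polynomials -/

/-- The probabilists' Hermite polynomials with real coefficients. -/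
noncomputable def hermiteReal (n : ℕ) : Polynomial ℝ :=
  (Polynomial.hermite n).map (Int.castRingHom ℝ)

theorem eval_hermiteReal (n : ℕ) (z : ℝ) :
    (hermiteReal n).eval z = Polynomial.aeval z (Polynomial.hermite n) := by
  rw [hermiteReal, Polynomial.eval_map, Polynomial.aeval_def]; rfl

theorem hermiteReal_succ (n : ℕ) :
    hermiteReal (n + 1) = Polynomial.X * hermiteReal n - (hermiteReal n).derivative := by
  simp [hermiteReal, Polynomial.hermite_succ, Polynomial.derivative_map]

theorem span_hermiteReal : Submodule.span ℝ (Set.range hermiteReal) = ⊤ := by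
  have hmonic : ∀ n, (hermiteReal n).Monic := fun n => (Polynomial.hermite_monic n).map _
  let S : Polynomial.Sequence ℝ :=
    { elems' := hermiteReal
      degree_eq' := fun n => by
        rw [hermiteReal, (Polynomial.hermite_monic n).degree_map, Polynomial.degree_hermite] }
  exact S.span fun n => by
    have : (S n).leadingCoeff = 1 := hmonic n
    simp [this]

/-- Completeness of the Hermite polynomials: they span all polynomials, so orthogonality to every
one of them makes all moments vanish. -/
theorem ae_eq_zero_of_integral_mul_hermiteReal {μ : Measure ℝ} {h : ℝ → ℝ}
    (hint : ∀ t : ℝ, Integrable (fun z => h z * Real.exp (t * |z|)) μ)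
    (hherm : ∀ n : ℕ, ∫ z, h z * (hermiteReal n).eval z ∂μ = 0) : h =ᵐ[μ] 0 := by
  have hi := integrable_mul_eval_of_integrable_mul_exp hint
  let L : Polynomial ℝ →ₗ[ℝ] ℝ :=
    { toFun := fun p => ∫ z, h z * p.eval z ∂μ
      map_add' := fun p q => by
        simp only [Polynomial.eval_add, mul_add]
        exact integral_add (hi p) (hi q)
      map_smul' := fun c p => by
        simp only [Polynomial.eval_smul, smul_eq_mul, RingHom.id_apply, mul_left_comm _ c]
        exact integral_const_mul _ _ }
  have hL : L = 0 := LinearMap.ext_on_range span_hermiteReal fun n => by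
    simpa [L] using hherm n
  refine ae_eq_zero_of_moments hint fun n => ?_
  have := LinearMap.congr_fun hL (Polynomial.X ^ n)
  simpa [L] using this

/-! ### Differentiating Gaussian transforms -/

/-- The kernel `p(z) exp(-z²/2)` with a polynomial prefactor `p`. -/
noncomputable def gaussKernel (p : Polynomial ℝ) (z : ℝ) : ℝ :=
  p.eval z * Real.exp (-z ^ 2 / 2)

/-- The transform `(x, y) ↦ ∫ G(u) p((u - x) / y) exp(-((u - x) / y)² / 2) du`; up to the factor
`√(2π) y` it is the expectation of `G(x + Zy) p(Z)` for a standard Gaussian `Z`. -/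
noncomputable def gaussTransform (G : ℝ → ℝ) (p : Polynomial ℝ) (q : ℝ × ℝ) : ℝ :=
  ∫ u, G u * gaussKernel p ((u - q.1) / q.2)

theorem continuous_gaussKernel (p : Polynomial ℝ) : Continuous (gaussKernel p) := by
  unfold gaussKernel; fun_prop

/-- Differentiating the kernel replaces `p` by `-(X p - p')`. -/
theorem hasDerivAt_gaussKernel (p : Polynomial ℝ) (z : ℝ) :
    HasDerivAt (gaussKernel p) (-gaussKernel (Polynomial.X * p - p.derivative) z) z := by
  have h1 : HasDerivAt (fun z : ℝ => -z ^ 2 / 2) (-z) z :=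
    ((hasDerivAt_pow 2 z).fun_neg.div_const 2).congr_deriv (by norm_num; ring)
  have h := (p.hasDerivAt z).mul h1.exp
  refine h.congr_deriv ?_
  simp only [gaussKernel, Polynomial.eval_sub, Polynomial.eval_mul, Polynomial.eval_X]
  ring

theorem abs_eval_le_mul_exp (p : Polynomial ℝ) {θ : ℝ} (hθ : 0 < θ) :
    ∃ C, 0 ≤ C ∧ ∀ z, |p.eval z| ≤ C * Real.exp (θ * z ^ 2) := by
  induction p using Polynomial.induction_on' with
  | add p q hp hq =>
    obtain ⟨C, hC, h⟩ := hp
    obtain ⟨D, hD, h'⟩ := hq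
    refine ⟨C + D, add_nonneg hC hD, fun z => ?_⟩
    rw [Polynomial.eval_add, add_mul]
    exact (abs_add_le _ _).trans (add_le_add (h z) (h' z))
  | monomial n c =>
    refine ⟨|c| * n.factorial * Real.exp (1 / (4 * θ)), by positivity, fun z => ?_⟩
    have h1 := Real.pow_div_factorial_le_exp |z| (abs_nonneg z) n
    rw [div_le_iff₀ (by positivity)] at h1
    -- Young's inequality turns the exponential of `|z|` into a Gaussian factor
    have h2 : |z| ≤ 1 / (4 * θ) + θ * z ^ 2 := by
      rw [← sq_abs z, ← sub_nonneg]
      have : 1 / (4 * θ) + θ * |z| ^ 2 - |z| = (2 * θ * |z| - 1) ^ 2 / (4 * θ) := by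
        field_simp; ring
      rw [this]; positivity
    rw [Polynomial.eval_monomial, abs_mul, abs_pow]
    calc |c| * |z| ^ n ≤ |c| * (Real.exp (1 / (4 * θ) + θ * z ^ 2) * n.factorial) := by
          gcongr
          exact h1.trans (by gcongr)
      _ = _ := by rw [Real.exp_add]; ring

/-- Near a point with scale `y₀ < M`, all kernels of scale about `y₀` are dominated by one Gaussian
of scale `M`, whatever its centre `a`. -/
theorem eventually_abs_gaussKernel_le (p : Polynomial ℝ) {x₀ y₀ M : ℝ} (a : ℝ) (hy₀ : 0 < y₀)
    (hM : y₀ < M) :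
    ∃ C, ∀ᶠ q : ℝ × ℝ in nhds (x₀, y₀), ∀ u,
      |gaussKernel p ((u - q.1) / q.2)| ≤ C * Real.exp (-((u - a) / M) ^ 2 / 2) := by
  obtain ⟨y₁, hy₀₁, hy₁⟩ := exists_between hM
  have hM0 : 0 < M := hy₀.trans hM
  set r := y₁ / M with hr
  have hr0 : 0 < r := div_pos (hy₀.trans hy₀₁) hM0
  have hr1 : r < 1 := (div_lt_one hM0).mpr hy₁
  set ε := (1 - r ^ 2) / 2 with hε
  have hε0 : 0 < ε := by
    have : r ^ 2 < 1 := by nlinarith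
    simp only [hε]; linarith
  set D := (|x₀ - a| + 1) / M with hD
  obtain ⟨C, hC0, hC⟩ := abs_eval_le_mul_exp p (half_pos hε0)
  refine ⟨C * Real.exp ((D ^ 2 / ε + D ^ 2) / 2), ?_⟩
  have hev1 : ∀ᶠ q : ℝ × ℝ in nhds (x₀, y₀), |q.1 - x₀| < 1 := by
    refine (continuous_fst.sub continuous_const).abs.continuousAt.eventually_lt
      continuousAt_const ?_
    simp
  have hev2 : ∀ᶠ q : ℝ × ℝ in nhds (x₀, y₀), 0 < q.2 :=
    continuousAt_const.eventually_lt continuous_snd.continuousAt hy₀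
  have hev3 : ∀ᶠ q : ℝ × ℝ in nhds (x₀, y₀), q.2 < y₁ :=
    continuous_snd.continuousAt.eventually_lt continuousAt_const hy₀₁
  filter_upwards [hev1, hev2, hev3] with q h1 h2 h3 u
  -- in units of `M` the large-scale variable is `(u - a) / M = s z + d` with `s ≤ r < 1` and `d`
  -- bounded, so that `((u - a) / M)² ≤ (1 - ε) z² + O(1)`; the spare `ε z²` absorbs `p`
  set z := (u - q.1) / q.2 with hz
  set d := (q.1 - a) / M with hd
  set s := q.2 / M with hs
  have hs0 : 0 < s := div_pos h2 hM0
  have hsr : s ≤ r := by simp only [hs, hr]; gcongr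
  have hdD : |d| ≤ D := by
    rw [hd, hD, abs_div, abs_of_pos hM0]
    gcongr
    calc |q.1 - a| = |(x₀ - a) + (q.1 - x₀)| := by ring_nf
      _ ≤ |x₀ - a| + |q.1 - x₀| := abs_add_le _ _
      _ ≤ _ := by linarith
  have hw : (u - a) / M = s * z + d := by
    simp only [hs, hz, hd]; field_simp; ring
  have hD0 : 0 ≤ D := (abs_nonneg d).trans hdD
  have hd2 : d ^ 2 ≤ D ^ 2 := by rw [← sq_abs d]; gcongr
  have hs2 : s ^ 2 * z ^ 2 ≤ r ^ 2 * z ^ 2 := by gcongr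
  have hcross : 2 * (s * z * d) ≤ ε * z ^ 2 + D ^ 2 / ε := by
    have hsd : (s * d) ^ 2 ≤ D ^ 2 := by
      calc (s * d) ^ 2 = s ^ 2 * d ^ 2 := by ring
        _ ≤ 1 * D ^ 2 := by
          gcongr
          nlinarith
        _ = D ^ 2 := one_mul _
    have hsd' : (s * d) ^ 2 / ε ≤ D ^ 2 / ε := by gcongr
    have : ε * z ^ 2 + (s * d) ^ 2 / ε - 2 * (s * z * d) = (ε * z - s * d) ^ 2 / ε := by
      field_simp; ring
    have : 0 ≤ (ε * z - s * d) ^ 2 / ε := by positivity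
    linarith
  have hmain : ((u - a) / M) ^ 2 ≤ (1 - ε) * z ^ 2 + (D ^ 2 / ε + D ^ 2) := by
    have hr2 : r ^ 2 = 1 - 2 * ε := by simp only [hε]; ring
    rw [hr2] at hs2
    rw [hw]
    nlinarith
  rw [gaussKernel, abs_mul, Real.abs_exp]
  calc |p.eval z| * Real.exp (-z ^ 2 / 2)
      ≤ C * Real.exp (ε / 2 * z ^ 2) * Real.exp (-z ^ 2 / 2) := by gcongr; exact hC z
    _ = C * Real.exp (ε / 2 * z ^ 2 + -z ^ 2 / 2) := by rw [Real.exp_add]; ring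
    _ ≤ C * Real.exp ((D ^ 2 / ε + D ^ 2) / 2 + -((u - a) / M) ^ 2 / 2) := by
        exact mul_le_mul_of_nonneg_left (Real.exp_le_exp.mpr (by linarith)) hC0
    _ = _ := by rw [Real.exp_add]; ring

section Transform

variable {G : ℝ → ℝ} {a M : ℝ}

theorem aestronglyMeasurable_mul_gaussKernel (hG : AEStronglyMeasurable G volume)
    (p : Polynomial ℝ) (q : ℝ × ℝ) :
    AEStronglyMeasurable (fun u => G u * gaussKernel p ((u - q.1) / q.2)) volume := by
  refine hG.mul (Continuous.aestronglyMeasurable ?_)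
  exact (continuous_gaussKernel p).comp (by fun_prop)

theorem integrable_mul_gaussKernel (hG : AEStronglyMeasurable G volume)
    (hint : Integrable (fun u => G u * Real.exp (-((u - a) / M) ^ 2 / 2)))
    (p : Polynomial ℝ) {q : ℝ × ℝ} (hq : 0 < q.2) (hqM : q.2 < M) :
    Integrable (fun u => G u * gaussKernel p ((u - q.1) / q.2)) := by
  obtain ⟨C, hC⟩ := eventually_abs_gaussKernel_le p (x₀ := q.1) a hq hqM
  refine (hint.norm.const_mul C).mono' (aestronglyMeasurable_mul_gaussKernel hG p q)
    (Filter.Eventually.of_forall fun u => ?_)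
  have h := hC.self_of_nhds u
  simp only [norm_mul, Real.norm_eq_abs, Real.abs_exp]
  calc _ ≤ |G u| * (C * Real.exp (-((u - a) / M) ^ 2 / 2)) := by gcongr
    _ = _ := by ring

theorem hasFDerivAt_gaussKernel_comp (p : Polynomial ℝ) (u : ℝ) {q : ℝ × ℝ} (hq : 0 < q.2) :
    HasFDerivAt (fun q : ℝ × ℝ => gaussKernel p ((u - q.1) / q.2))
      ((q.2⁻¹ * gaussKernel (Polynomial.X * p - p.derivative) ((u - q.1) / q.2)) •
          ContinuousLinearMap.fst ℝ ℝ ℝ +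
        (q.2⁻¹ * gaussKernel (Polynomial.X * (Polynomial.X * p - p.derivative))
          ((u - q.1) / q.2)) • ContinuousLinearMap.snd ℝ ℝ ℝ) q := by
  have h1 : HasFDerivAt (fun q : ℝ × ℝ => u - q.1) (-ContinuousLinearMap.fst ℝ ℝ ℝ) q :=
    hasFDerivAt_fst.const_sub u
  have h2 : HasFDerivAt (fun q : ℝ × ℝ => q.2) (ContinuousLinearMap.snd ℝ ℝ ℝ) q := hasFDerivAt_snd
  have h3 : HasFDerivAt (fun q : ℝ × ℝ => q.2⁻¹) (-(q.2 ^ 2)⁻¹ • ContinuousLinearMap.snd ℝ ℝ ℝ) q :=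
    (hasDerivAt_inv hq.ne').comp_hasFDerivAt q h2
  have h4 := (hasDerivAt_gaussKernel p ((u - q.1) * q.2⁻¹)).comp_hasFDerivAt q (h1.mul h3)
  simp only [div_eq_mul_inv]
  refine h4.congr_fderiv ?_
  ext <;> simp [gaussKernel] <;> field_simp

/-- The partial derivatives of a Gaussian transform are, up to the factor `y⁻¹`, transforms with
other polynomials. In the first variable the polynomial `p` becomes `X p - p'`, which is the raising
rule of the Hermite polynomials. -/
theorem hasFDerivAt_gaussTransform (hG : AEStronglyMeasurable G volume)
    (hint : Integrable (fun u => G u * Real.exp (-((u - a) / M) ^ 2 / 2)))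
    (p : Polynomial ℝ) {q : ℝ × ℝ} (hq : 0 < q.2) (hqM : q.2 < M) :
    HasFDerivAt (gaussTransform G p)
      ((q.2⁻¹ * gaussTransform G (Polynomial.X * p - p.derivative) q) •
          ContinuousLinearMap.fst ℝ ℝ ℝ +
        (q.2⁻¹ * gaussTransform G (Polynomial.X * (Polynomial.X * p - p.derivative)) q) •
          ContinuousLinearMap.snd ℝ ℝ ℝ) q := by
  set r := Polynomial.X * p - p.derivative with hr
  obtain ⟨C, hC⟩ := eventually_abs_gaussKernel_le r (x₀ := q.1) a hq hqM
  obtain ⟨D, hD⟩ := eventually_abs_gaussKernel_le (Polynomial.X * r) (x₀ := q.1) a hq hqM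
  have hhalf : ∀ᶠ q' : ℝ × ℝ in nhds q, q.2 / 2 < q'.2 :=
    continuousAt_const.eventually_lt continuous_snd.continuousAt (half_lt_self hq)
  let F' : ℝ × ℝ → ℝ → ℝ × ℝ →L[ℝ] ℝ := fun q u =>
    (q.2⁻¹ * (G u * gaussKernel r ((u - q.1) / q.2))) • ContinuousLinearMap.fst ℝ ℝ ℝ +
      (q.2⁻¹ * (G u * gaussKernel (Polynomial.X * r) ((u - q.1) / q.2))) •
        ContinuousLinearMap.snd ℝ ℝ ℝ
  have hi := (integrable_mul_gaussKernel hG hint r hq hqM).const_mul q.2⁻¹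
  have hi' := (integrable_mul_gaussKernel hG hint (Polynomial.X * r) hq hqM).const_mul q.2⁻¹
  have hF' : AEStronglyMeasurable (F' q) volume :=
    ((hi.smul_const (ContinuousLinearMap.fst ℝ ℝ ℝ)).add
      (hi'.smul_const (ContinuousLinearMap.snd ℝ ℝ ℝ))).aestronglyMeasurable
  have key := hasFDerivAt_integral_of_dominated_of_fderiv_le (μ := volume) (𝕜 := ℝ)
    (F := fun q u => G u * gaussKernel p ((u - q.1) / q.2)) (F' := F') (x₀ := q)
    (bound := fun u => (q.2 / 2)⁻¹ * (C + D) * |G u * Real.exp (-((u - a) / M) ^ 2 / 2)|)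
    ((hC.and hD).and hhalf)
    (Filter.Eventually.of_forall fun q' => aestronglyMeasurable_mul_gaussKernel hG p q')
    (integrable_mul_gaussKernel hG hint p hq hqM)
    hF'
    (Filter.Eventually.of_forall fun u q' hq' => ?_)
    (hint.norm.const_mul _)
    (Filter.Eventually.of_forall fun u q' hq' => ?_)
  · refine key.congr_fderiv ?_
    simp only [F']
    rw [integral_add (hi.smul_const _) (hi'.smul_const _), integral_smul_const,
      integral_smul_const, integral_const_mul, integral_const_mul]
    rfl
  · obtain ⟨⟨hCq, hDq⟩, hlt⟩ := hq'
    have hpos : 0 < q'.2 := (half_pos hq).trans hlt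
    have hinv : q'.2⁻¹ ≤ (q.2 / 2)⁻¹ := inv_anti₀ (half_pos hq) hlt.le
    have hfst := ContinuousLinearMap.norm_fst_le ℝ ℝ ℝ
    have hsnd := ContinuousLinearMap.norm_snd_le ℝ ℝ ℝ
    have hbd : ∀ {k E : ℝ}, |k| ≤ E * Real.exp (-((u - a) / M) ^ 2 / 2) →
        |q'.2⁻¹ * (G u * k)| ≤
          (q.2 / 2)⁻¹ * (E * |G u * Real.exp (-((u - a) / M) ^ 2 / 2)|) := by
      intro k E hk
      rw [abs_mul, abs_mul, abs_mul, Real.abs_exp, abs_of_pos (inv_pos.mpr hpos)]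
      calc _ ≤ (q.2 / 2)⁻¹ * (|G u| * (E * Real.exp (-((u - a) / M) ^ 2 / 2))) := by gcongr
        _ = _ := by ring
    refine (norm_add_le _ _).trans ?_
    rw [norm_smul, norm_smul, Real.norm_eq_abs, Real.norm_eq_abs]
    calc _ ≤ (q.2 / 2)⁻¹ * (C * |G u * Real.exp (-((u - a) / M) ^ 2 / 2)|) * 1 +
          (q.2 / 2)⁻¹ * (D * |G u * Real.exp (-((u - a) / M) ^ 2 / 2)|) * 1 := by
          gcongr
          · exact (abs_nonneg _).trans (hbd (hCq u))
          · exact hbd (hCq u)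
          · exact (abs_nonneg _).trans (hbd (hDq u))
          · exact hbd (hDq u)
      _ = _ := by ring
  · have hpos : 0 < q'.2 := (half_pos hq).trans hq'.2
    refine ((hasFDerivAt_gaussKernel_comp p u hpos).const_mul (G u)).congr_fderiv ?_
    simp only [F', smul_add, smul_smul, ← hr]
    congr 2 <;> ring

/-- The derivative is built from transforms again, hence is continuous, so it is a strict
derivative. -/
theorem hasStrictFDerivAt_gaussTransform (hG : AEStronglyMeasurable G volume)
    (hint : Integrable (fun u => G u * Real.exp (-((u - a) / M) ^ 2 / 2)))
    (p : Polynomial ℝ) {q : ℝ × ℝ} (hq : 0 < q.2) (hqM : q.2 < M) :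
    HasStrictFDerivAt (gaussTransform G p)
      ((q.2⁻¹ * gaussTransform G (Polynomial.X * p - p.derivative) q) •
          ContinuousLinearMap.fst ℝ ℝ ℝ +
        (q.2⁻¹ * gaussTransform G (Polynomial.X * (Polynomial.X * p - p.derivative)) q) •
          ContinuousLinearMap.snd ℝ ℝ ℝ) q := by
  refine hasStrictFDerivAt_of_hasFDerivAt_of_continuousAt (f' := fun q : ℝ × ℝ =>
      (q.2⁻¹ * gaussTransform G (Polynomial.X * p - p.derivative) q) •
          ContinuousLinearMap.fst ℝ ℝ ℝ +
        (q.2⁻¹ * gaussTransform G (Polynomial.X * (Polynomial.X * p - p.derivative)) q) •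
          ContinuousLinearMap.snd ℝ ℝ ℝ) ?_ ?_
  · filter_upwards [continuousAt_const.eventually_lt continuous_snd.continuousAt hq,
      continuous_snd.continuousAt.eventually_lt continuousAt_const hqM] with q' h h'
    exact hasFDerivAt_gaussTransform hG hint p h h'
  · have hc := fun r => (hasFDerivAt_gaussTransform hG hint r hq hqM).continuousAt
    have hinv : ContinuousAt (fun q : ℝ × ℝ => q.2⁻¹) q := continuous_snd.continuousAt.inv₀ hq.ne'
    exact ((hinv.mul (hc _)).smul continuousAt_const).add
      ((hinv.mul (hc _)).smul continuousAt_const)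

end Transform

/-! ### Hermite moments as Gaussian transforms -/

instance isProbabilityMeasure_stdGaussian1 : IsProbabilityMeasure stdGaussian1 := by
  unfold stdGaussian1; infer_instance

theorem gaussianPDFReal_zero_one (z : ℝ) :
    gaussianPDFReal 0 1 z = (Real.sqrt (2 * Real.pi))⁻¹ * Real.exp (-z ^ 2 / 2) := by
  simp [gaussianPDFReal]

theorem quasiMeasurePreserving_affine (x : ℝ) {y : ℝ} (hy : y ≠ 0) :
    Measure.QuasiMeasurePreserving (fun z : ℝ => x + z * y) := by
  have h1 : Measure.QuasiMeasurePreserving (fun z : ℝ => z * y) := by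
    refine ⟨by fun_prop, ?_⟩
    rw [Real.map_volume_mul_right hy]
    exact Measure.smul_absolutelyContinuous
  exact (measurePreserving_add_left volume x).quasiMeasurePreserving.comp h1

/-- Integrability of `f(x + Zy)` as a Gaussian weighted integrability of `f`. -/
theorem integrable_comp_affine_stdGaussian1_iff (f : ℝ → ℝ) (x : ℝ) {y : ℝ} (hy : y ≠ 0) :
    Integrable (fun z => f (x + z * y)) stdGaussian1 ↔
      Integrable (fun u => f u * Real.exp (-((u - x) / y) ^ 2 / 2)) := by
  rw [stdGaussian1, gaussianReal_of_var_ne_zero 0 one_ne_zero,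
    integrable_withDensity_iff_integrable_smul' (measurable_gaussianPDF 0 1)
      (Filter.Eventually.of_forall fun _ => gaussianPDF_lt_top)]
  have h : ∀ z, (gaussianPDF 0 1 z).toReal • f (x + z * y) = (Real.sqrt (2 * Real.pi))⁻¹ *
      (f (x + z * y) * Real.exp (-((x + z * y - x) / y) ^ 2 / 2)) := fun z => by
    rw [toReal_gaussianPDF, gaussianPDFReal_zero_one, add_sub_cancel_left,
      mul_div_cancel_right₀ _ hy, smul_eq_mul]
    ring
  simp_rw [h]
  rw [integrable_const_mul_iff (by rw [isUnit_iff_ne_zero]; positivity)]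
  rw [integrable_comp_mul_right_iff
    (fun w => f (x + w) * Real.exp (-((x + w - x) / y) ^ 2 / 2)) hy]
  exact (measurePreserving_add_left volume x).integrable_comp_emb
    (measurableEmbedding_addLeft x)
    (g := fun u => f u * Real.exp (-((u - x) / y) ^ 2 / 2))

theorem integral_comp_affine_mul_eval (f : ℝ → ℝ) (p : Polynomial ℝ) (x : ℝ) {y : ℝ}
    (hy : 0 < y) :
    ∫ z, f (x + z * y) * p.eval z ∂stdGaussian1 =
      (Real.sqrt (2 * Real.pi))⁻¹ * y⁻¹ * gaussTransform f p (x, y) := by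
  rw [stdGaussian1, integral_gaussianReal_eq_integral_smul one_ne_zero]
  have h : ∀ z, gaussianPDFReal 0 1 z • (f (x + z * y) * p.eval z) = (Real.sqrt (2 * Real.pi))⁻¹ *
      (f (x + z * y) * gaussKernel p ((x + z * y - x) / y)) := fun z => by
    rw [gaussianPDFReal_zero_one, add_sub_cancel_left,
      mul_div_cancel_right₀ _ hy.ne', smul_eq_mul, gaussKernel]
    ring
  simp_rw [h]
  rw [integral_const_mul, Measure.integral_comp_mul_right
    (fun w => f (x + w) * gaussKernel p ((x + w - x) / y)) y,
    integral_add_left_eq_self (fun u => f u * gaussKernel p ((u - x) / y)) x,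
    abs_of_pos (inv_pos.mpr hy), smul_eq_mul, mul_assoc]
  rfl

/-- After the substitution `u = x + z y` the dependence on `(x, y)` sits in the smooth kernel instead
of in `G`. -/
theorem hermiteMoment_comp_affine (G : ℝ → ℝ) (n : ℕ) {q : ℝ × ℝ} (hq : 0 < q.2) :
    hermiteMoment (fun z => G (q.1 + z * q.2)) n =
      (Real.sqrt (2 * Real.pi))⁻¹ * q.2⁻¹ * gaussTransform G (hermiteReal n) q := by
  rw [← integral_comp_affine_mul_eval G (hermiteReal n) q.1 hq]
  simp_rw [eval_hermiteReal]
  rfl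

/-! ### Functions of infinite Hermite rank -/

theorem integrable_gaussKernel (p : Polynomial ℝ) : Integrable (gaussKernel p) := by
  obtain ⟨C, -, hC⟩ := abs_eval_le_mul_exp p (show (0 : ℝ) < 1 / 4 by norm_num)
  refine ((integrable_exp_neg_mul_sq (show (0 : ℝ) < 1 / 4 by norm_num)).const_mul C).mono'
    (continuous_gaussKernel p).aestronglyMeasurable (Filter.Eventually.of_forall fun z => ?_)
  rw [gaussKernel, norm_mul, Real.norm_eq_abs, Real.norm_eq_abs, Real.abs_exp]
  calc _ ≤ C * Real.exp (1 / 4 * z ^ 2) * Real.exp (-z ^ 2 / 2) := by gcongr; exact hC z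
    _ = C * Real.exp (-(1 / 4) * z ^ 2) := by
      rw [mul_assoc, ← Real.exp_add]; ring_nf

/-- `H_{n+1}(z) exp(-z²/2)` is the derivative of `-H_n(z) exp(-z²/2)`, so it has integral zero. -/
theorem integral_hermiteReal_succ (n : ℕ) :
    ∫ z, (hermiteReal (n + 1)).eval z ∂stdGaussian1 = 0 := by
  have h0 : ∫ z, -gaussKernel (hermiteReal (n + 1)) z = 0 := by
    refine integral_eq_zero_of_hasDerivAt_of_integrable (f := gaussKernel (hermiteReal n))
      (fun z => ?_) (integrable_gaussKernel _).neg (integrable_gaussKernel _)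
    rw [hermiteReal_succ]
    exact hasDerivAt_gaussKernel _ z
  rw [integral_neg, neg_eq_zero] at h0
  have := integral_comp_affine_mul_eval (fun _ => 1) (hermiteReal (n + 1)) 0 one_pos
  simp only [one_mul, gaussTransform, sub_zero, div_one, h0, mul_zero] at this
  exact this

theorem memLp_two_exp_mul_abs_stdGaussian1 (t : ℝ) :
    MemLp (fun z : ℝ => Real.exp (t * |z|)) 2 stdGaussian1 := by
  rw [memLp_two_iff_integrable_sq (by fun_prop)]
  have h := integrable_exp_mul_abs (X := fun z : ℝ => z) (μ := stdGaussian1) (t := 2 * t)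
    (integrable_exp_mul_gaussianReal (2 * t)) (integrable_exp_mul_gaussianReal (-(2 * t)))
  refine h.congr (Filter.Eventually.of_forall fun z => ?_)
  simp only
  rw [← Real.exp_nat_mul]
  push_cast
  ring_nf

/-- A square integrable function of infinite Hermite rank is almost everywhere constant. -/
theorem exists_ae_eq_const_of_integral_hermiteReal_succ {g : ℝ → ℝ}
    (hg : MemLp g 2 stdGaussian1)
    (hherm : ∀ n : ℕ, ∫ z, g z * (hermiteReal (n + 1)).eval z ∂stdGaussian1 = 0) :
    ∃ c, ∀ᵐ z ∂stdGaussian1, g z = c := by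
  have hexp : ∀ {k : ℝ → ℝ}, MemLp k 2 stdGaussian1 → ∀ t : ℝ,
      Integrable (fun z => k z * Real.exp (t * |z|)) stdGaussian1 := fun hk t =>
    hk.integrable_mul (memLp_two_exp_mul_abs_stdGaussian1 t)
  set c := ∫ z, g z ∂stdGaussian1 with hc
  have hcm : MemLp (fun _ : ℝ => c) 2 stdGaussian1 := memLp_const c
  refine ⟨c, ?_⟩
  have key : (fun z => g z - c) =ᵐ[stdGaussian1] 0 := by
    refine ae_eq_zero_of_integral_mul_hermiteReal (hexp (hg.sub hcm)) fun n => ?_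
    simp_rw [sub_mul]
    rw [integral_sub (integrable_mul_eval_of_integrable_mul_exp (hexp hg) _)
      (integrable_mul_eval_of_integrable_mul_exp (hexp hcm) _)]
    cases n with
    | zero => simp [hermiteReal, hc]
    | succ n => rw [hherm, integral_const_mul, integral_hermiteReal_succ]; simp
  filter_upwards [key] with z hz
  exact sub_eq_zero.mp hz

/-! ### The high rank set -/

theorem hermiteMoment_one_eq_zero_of_two_le_hermiteRank {f : ℝ → ℝ} (h : 2 ≤ hermiteRank f) :
    hermiteMoment f 1 = 0 := by
  by_contra hne
  have : hermiteRank f ≤ ((1 : ℕ) : ℕ∞) := sInf_le ⟨1, le_rfl, hne, rfl⟩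
  have h2 := h.trans this
  norm_num at h2

/-- The high rank set is covered by the countably many strata on which `H_{n+1}` has vanishing
transform and `H_{n+2}` does not; each is a regular zero set. -/
theorem dimH_highRankSet_le_one {G : ℝ → ℝ} {M₁ M₂ a : ℝ} (hG : AEStronglyMeasurable G volume)
    (hconst : ¬ ∃ c : ℝ, ∀ᵐ u ∂(volume : Measure ℝ), G u = c)
    (hint : Integrable (fun u => G u * Real.exp (-((u - a) / M₂) ^ 2 / 2)))
    (hmem : ∀ x ∈ Set.Ioo (-M₁) M₁, ∀ y ∈ Set.Ioo 0 M₂,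
      MemLp (fun z : ℝ => G (x + z * y)) 2 stdGaussian1) :
    dimH (highRankSet G M₁ M₂) ≤ 1 := by
  let S : ℕ → Set (ℝ × ℝ) := fun n => {q | (0 < q.2 ∧ q.2 < M₂) ∧
    gaussTransform G (hermiteReal (n + 1)) q = 0 ∧ gaussTransform G (hermiteReal (n + 2)) q ≠ 0}
  have hS : ∀ n, dimH (S n) ≤ 1 := fun n =>
    dimH_le_one_of_hasStrictFDerivAt (g := gaussTransform G (hermiteReal (n + 1)))
      (fun q hq => hq.2.1) fun q hq =>
      ⟨_, hasStrictFDerivAt_gaussTransform hG hint _ hq.1.1 hq.1.2, by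
        simpa [← hermiteReal_succ, hq.1.1.ne'] using hq.2.2⟩
  have hsub : highRankSet G M₁ M₂ ⊆ ⋃ n, S n := by
    rintro q ⟨⟨hq1, hq2⟩, hrank⟩
    have hpos : 0 < q.2 := hq2.1
    have hscale : (Real.sqrt (2 * Real.pi))⁻¹ * q.2⁻¹ ≠ 0 := by positivity
    have h1 : gaussTransform G (hermiteReal 1) q = 0 := by
      have := hermiteMoment_one_eq_zero_of_two_le_hermiteRank hrank
      rw [hermiteMoment_comp_affine G 1 hpos] at this
      exact (mul_eq_zero.mp this).resolve_left hscale
    have hex : ∃ n, gaussTransform G (hermiteReal (n + 1)) q ≠ 0 := by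
      by_contra! hall
      obtain ⟨c, hc⟩ := exists_ae_eq_const_of_integral_hermiteReal_succ (hmem _ hq1 _ hq2)
        fun n => by
          rw [integral_comp_affine_mul_eval G _ q.1 hpos, hall n, mul_zero]
      refine hconst ⟨c, ?_⟩
      have hc' := gaussianReal_absolutelyContinuous' 0 one_ne_zero |>.ae_le hc
      filter_upwards [(quasiMeasurePreserving_affine (-q.1 / q.2)
        (inv_ne_zero hpos.ne')).ae hc'] with u hu
      rw [← hu]
      congr 1
      field_simp
      ring
    -- the stratum is given by the first Hermite moment of positive index that does not vanish
    classical
    have hspec := Nat.find_spec hex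
    obtain ⟨n, hn⟩ : ∃ n, Nat.find hex = n + 1 :=
      Nat.exists_eq_succ_of_ne_zero fun h0 => by
        rw [h0] at hspec
        exact hspec h1
    rw [hn] at hspec
    refine Set.mem_iUnion.mpr ⟨n, ⟨hq2.1, hq2.2⟩, ?_, hspec⟩
    exact not_not.mp (Nat.find_min hex (hn ▸ Nat.lt_succ_self n))
  calc dimH (highRankSet G M₁ M₂) ≤ dimH (⋃ n, S n) := dimH_mono hsub
    _ = ⨆ n, dimH (S n) := dimH_iUnion _
    _ ≤ 1 := iSup_le hS

theorem volume_eq_zero_of_dimH_le_one {S : Set (ℝ × ℝ)} (hS : dimH S ≤ 1) : volume S = 0 := by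
  rw [← hausdorffMeasure_prod_real]
  exact hausdorffMeasure_of_dimH_lt (d := 2) (hS.trans_lt (by norm_num))

theorem theorem2p3 (G : ℝ → ℝ) (M₁ M₂ : ℝ)
    (hG : AEMeasurable G volume)
    (hconst : ¬ ∃ c : ℝ, ∀ᵐ u ∂(volume : Measure ℝ), G u = c)
    (hplus : MemLp (fun z : ℝ => G (M₁ + z * M₂)) 2 stdGaussian1)
    (hminus : MemLp (fun z : ℝ => G (-M₁ + z * M₂)) 2 stdGaussian1) :
    (∀ x ∈ Set.Ioo (-M₁) M₁, ∀ y ∈ Set.Ioo 0 M₂,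
      MemLp (fun z : ℝ => G (x + z * y)) 2 stdGaussian1) ∧
    dimH (highRankSet G M₁ M₂) ≤ 1 ∧
    volume (highRankSet G M₁ M₂) = 0 := by
  have hGs := hG.aestronglyMeasurable
  have hmem : ∀ x ∈ Set.Ioo (-M₁) M₁, ∀ y ∈ Set.Ioo 0 M₂,
      MemLp (fun z : ℝ => G (x + z * y)) 2 stdGaussian1 := by
    rintro x - y ⟨hy, hyM⟩
    have hsq := (integrable_comp_affine_stdGaussian1_iff (fun u => G u ^ 2) M₁
      (hy.trans hyM).ne').mp hplus.integrable_sq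
    have hmeas : AEStronglyMeasurable (fun z => G (x + z * y)) stdGaussian1 :=
      (hGs.comp_quasiMeasurePreserving (quasiMeasurePreserving_affine x hy.ne')).mono_ac
        (gaussianReal_absolutelyContinuous 0 one_ne_zero)
    rw [memLp_two_iff_integrable_sq hmeas,
      integrable_comp_affine_stdGaussian1_iff (fun u => G u ^ 2) x hy.ne']
    -- a Gaussian of scale `y < M₂` is dominated by the one of scale `M₂`, here centred at `M₁`
    have := integrable_mul_gaussKernel (hGs.pow 2) hsq 1 (q := (x, y)) hy hyM
    simpa [gaussKernel] using this
  have hdim : dimH (highRankSet G M₁ M₂) ≤ 1 := by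
    rcases le_or_gt M₂ 0 with hM | hM
    · have : highRankSet G M₁ M₂ = ∅ := by simp [highRankSet, Set.Ioo_eq_empty_of_le hM]
      rw [this, dimH_empty]
      exact zero_le
    · exact dimH_highRankSet_le_one hGs hconst ((integrable_comp_affine_stdGaussian1_iff G M₁
        hM.ne').mp (hplus.integrable one_le_two)) hmem
  exact ⟨hmem, hdim, volume_eq_zero_of_dimH_le_one hdim⟩
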